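/- Let $G$ be a matrix Lie group, i.e. a closed subgroup of $GL(n,\mathbb R)$, with Lie algebra $\mathfrak g=\{x\in\mathbb R^{n\times n}: \exp(tx)\in G \text{ for all } t\in\mathbb R\}$ of dimension $d$. Fix a linear isomorphism $(\cdot)^\wedge:\mathbb R^d\to\mathfrak g$ with inverse $(\cdot)^\vee$, and put $\exp_{\rm m}(x)=\exp(x^\wedge)\in G$. For $x\in\mathbb R^d$ let $\mathrm{adm}_x$ be the $d\times d$ matrix with $\mathrm{adm}_x y=(x^\wedge y^\wedge-y^\wedge x^\wedge)^\vee$ and let $\mathrm{dexp_m}(x)=\sum_{i\ge 0}\frac{1}{(i+1)!}\mathrm{adm}_x^{\,i}$; for $X\in G$ and $w\in\mathbb R^d$ write $\mathrm{Ad}_X w=(Xw^\wedge X^{-1})^\vee$. Let $\log_{\rm m}$ be a Lie logarithm, that is, a continuous inverse of $\exp_{\rm m}$ on a neighbourhood $D\subseteq G$ of the identity: $\exp_{\rm m}(\log_{\rm m}X)=X$ for $X\in D$, and $\log_{\rm m}(\exp_{\rm m}x)=x$ for $x$ near $0$. Let $\mathcal U$ be a set of inputs and, for each $u\in\mathcal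 U$, let $f_u$ be a vector field on $G$ (so $X^{-1}f_u(X)\in\mathfrak g$ for $X\in G$) with the affine group property $$f_u(XY)=f_u(X)Y+Xf_u(Y)-Xf_u(I)Y,\qquad X,Y\in G,$$ such that $x\mapsto(\exp_{\rm m}(x)^{-1}f_u(\exp_{\rm m}(x)))^\vee$ is differentiable at $x=0$. Let $t_0\in\mathbb R$, $T\in(t_0,\infty]$, let $u_t\in\mathcal U$ be an input, let $w_t\in\mathbb R^d$ be a smooth disturbance on $[t_0,T)$, and let $X_t,\hat X_t\in G$ satisfy on $[t_0,T)$ $$\dot X_t=f_{u_t}(X_t)+X_tw_t^\wedge,\qquad \dot{\hat X}_t=f_{u_t}(\hat X_t).$$ Put $\eta^{\rm L}_t=\hat X_t^{-1}X_t$ and $\eta^{\rm R}_t=X_t\hat X_t^{-1}$. Let $A^{\rm L}_t$ and $A^{\rm R}_t$ be the differentials at $x=0$ of $x\mapsto(\exp_{\rm m}(x)^{-1}g_t(\exp_{\rm m}(x)))^\vee$ for, respectively, $g_t(\eta)=f_{u_t}(\eta)-f_{u_t}(I)\eta$ and $g_t(\eta)=f_{u_t}(\eta)-\eta f_{u_t}(I)$,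 the vector fields that govern the two errors when $w=0$. (LIE) If $\eta^{\rm L}_t\in D$ for all $t\in[t_0,T)$ and, with $\xi^{\rm L}_t=\log_{\rm m}(\eta^{\rm L}_t)$, the matrix $\mathrm{dexp_m}(-\xi^{\rm L}_t)$ is invertible for all $t\in[t_0,T)$, then $\xi^{\rm L}$ is differentiable on $[t_0,T)$ and $$\dot\xi^{\rm L}_t=\mathrm{dexp_m}(-\xi^{\rm L}_t)^{-1}w_t+A^{\rm L}_t\xi^{\rm L}_t .$$ (RIE) If $\eta^{\rm R}_t\in D$ for all $t\in[t_0,T)$ and, with $\xi^{\rm R}_t=\log_{\rm m}(\eta^{\rm R}_t)$, the matrix $\mathrm{dexp_m}(-\xi^{\rm R}_t)$ is invertible for all $t\in[t_0,T)$, then $\xi^{\rm R}$ is differentiable on $[t_0,T)$ and $$\dot\xi^{\rm R}_t=\mathrm{dexp_m}(-\xi^{\rm R}_t)^{-1}\,\mathrm{Ad}_{\hat X_t}w_t+A^{\rm R}_t\xi^{\rm R}_t .$$ At $t_0$ all derivatives are one-sided. -/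

import Mathlib

open scoped Matrix ContDiff Topology

noncomputable section

namespace MatrixLie

variable {n d : ℕ}

section Helpers

open Filter NormedSpace

open scoped Matrix.Norms.Operator

/-- If `γ 0 = 1` and `γ' (0) = z` then `γ (1 / k) ^ k → exp z`. -/
theorem tendsto_pow_exp {γ : ℝ → Matrix (Fin n) (Fin n) ℝ} {z : Matrix (Fin n) (Fin n) ℝ}
    (h0 : γ 0 = 1) (hγ : HasDerivAt γ z 0) :
    Tendsto (fun k : ℕ => γ ((k : ℝ)⁻¹) ^ k) atTop (𝓝 (exp z)) := by
  have hexp : HasStrictFDerivAt (exp : Matrix (Fin n) (Fin n) ℝ → Matrix (Fin n) (Fin n) ℝ)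
      ((ContinuousLinearEquiv.refl ℝ (Matrix (Fin n) (Fin n) ℝ) :
        Matrix (Fin n) (Fin n) ℝ ≃L[ℝ] Matrix (Fin n) (Fin n) ℝ) :
        Matrix (Fin n) (Fin n) ℝ →L[ℝ] Matrix (Fin n) (Fin n) ℝ) 0 :=
    hasStrictFDerivAt_exp_zero
  set lg := hexp.localInverse exp _ 0 with hlg
  have hlgd : HasFDerivAt lg _ (exp (0 : Matrix (Fin n) (Fin n) ℝ)) :=
    hexp.to_localInverse.hasFDerivAt
  have hlg0 : lg (exp (0 : Matrix (Fin n) (Fin n) ℝ)) = 0 := hexp.localInverse_apply_image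
  have hright : ∀ᶠ y in 𝓝 (exp (0 : Matrix (Fin n) (Fin n) ℝ)), exp (lg y) = y :=
    hexp.eventually_right_inverse
  rw [exp_zero] at hlgd hlg0 hright
  rw [← h0] at hlgd
  have hc : HasDerivAt (lg ∘ γ) z 0 := by
    exact hlgd.comp_hasDerivAt (0 : ℝ) hγ
  have hk0 : Tendsto (fun k : ℕ => ((k : ℝ)⁻¹)) atTop (𝓝 0) :=
    tendsto_inv_atTop_nhds_zero_nat
  have hk : Tendsto (fun k : ℕ => ((k : ℝ)⁻¹)) atTop (𝓝[≠] 0) := by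
    refine tendsto_nhdsWithin_iff.2 ⟨hk0, ?_⟩
    filter_upwards [eventually_gt_atTop 0] with k hk
    simp [hk.ne']
  have hs : Tendsto (fun k : ℕ => (k : ℝ) • lg (γ ((k : ℝ)⁻¹))) atTop (𝓝 z) := by
    have := (hasDerivAt_iff_tendsto_slope.1 hc).comp hk
    refine this.congr fun k => ?_
    simp [slope, h0, hlg0]
  have hr : ∀ᶠ k : ℕ in atTop, exp (lg (γ ((k : ℝ)⁻¹))) = γ ((k : ℝ)⁻¹) := by
    have h1 : Tendsto (fun k : ℕ => γ ((k : ℝ)⁻¹)) atTop (𝓝 1) := by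
      rw [← h0]; exact hγ.continuousAt.tendsto.comp hk0
    exact h1.eventually hright
  have he : Tendsto (fun k : ℕ => exp ((k : ℝ) • lg (γ ((k : ℝ)⁻¹)))) atTop (𝓝 (exp z)) :=
    (exp_continuous.tendsto z).comp hs
  refine he.congr' ?_
  filter_upwards [hr] with k hk
  rw [Nat.cast_smul_eq_nsmul, Matrix.exp_nsmul, hk]

/-- A limit of elements of `G` that is an invertible matrix lies in `G`. -/
theorem exists_mem_of_tendsto (G : ClosedSubgroup (GL (Fin n) ℝ))
    {M : ℕ → Matrix (Fin n) (Fin n) ℝ} {L : Matrix (Fin n) (Fin n) ℝ}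
    (hM : ∀ k, ∃ g ∈ G, (g : Matrix (Fin n) (Fin n) ℝ) = M k) (hL : IsUnit L)
    (h : Tendsto M atTop (𝓝 L)) : ∃ g ∈ G, (g : Matrix (Fin n) (Fin n) ℝ) = L := by
  choose g hg hgM using hM
  obtain ⟨l, rfl⟩ := hL
  refine ⟨l, ?_, rfl⟩
  have hl : Tendsto g atTop (𝓝 l) := by
    have he := (Units.isOpenEmbedding_val (R := Matrix (Fin n) (Fin n) ℝ)).isEmbedding
    refine he.tendsto_nhds_iff.2 ?_
    have hM' : (Units.val ∘ g : ℕ → Matrix (Fin n) (Fin n) ℝ) = M := funext hgM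
    exact hM' ▸ h
  exact G.isClosed'.mem_of_tendsto hl (Eventually.of_forall hg)

/-- A differentiable curve of elements of `G` through `1` has its velocity in the Lie algebra. -/
theorem exp_mem_of_curve (G : ClosedSubgroup (GL (Fin n) ℝ))
    {γ : ℝ → Matrix (Fin n) (Fin n) ℝ} {z : Matrix (Fin n) (Fin n) ℝ}
    (hG : ∀ s, ∃ g ∈ G, (g : Matrix (Fin n) (Fin n) ℝ) = γ s)
    (h0 : γ 0 = 1) (hγ : HasDerivAt γ z 0) (t : ℝ) :
    ∃ g ∈ G, (g : Matrix (Fin n) (Fin n) ℝ) = exp (t • z) := by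
  have h1 : HasDerivAt (fun s => γ (t * s)) (t • z) 0 := by
    have h2 : HasDerivAt (fun s : ℝ => t * s) t 0 := by
      simpa using (hasDerivAt_id (0 : ℝ)).const_mul t
    have h3 : HasDerivAt γ z (t * 0) := by simpa using hγ
    exact h3.scomp (0 : ℝ) h2
  refine exists_mem_of_tendsto G (fun k => ?_) (Matrix.isUnit_exp _)
    (tendsto_pow_exp (γ := fun s => γ (t * s)) (by simpa using h0) h1)
  obtain ⟨g, hg, hgγ⟩ := hG (t * (k : ℝ)⁻¹)
  exact ⟨g ^ k, pow_mem hg k, by simp [hgγ]⟩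

theorem hasDerivAt_exp_smul_zero (x : Matrix (Fin n) (Fin n) ℝ) :
    HasDerivAt (fun s : ℝ => exp (s • x)) x 0 := by
  have h := hasDerivAt_exp_smul_const (𝕂 := ℝ) x (0 : ℝ)
  rw [zero_smul, exp_zero, one_mul] at h
  exact h

theorem exp_add_mem (G : ClosedSubgroup (GL (Fin n) ℝ)) {x y : Matrix (Fin n) (Fin n) ℝ}
    (hx : ∀ t : ℝ, ∃ g ∈ G, (g : Matrix (Fin n) (Fin n) ℝ) = exp (t • x))
    (hy : ∀ t : ℝ, ∃ g ∈ G, (g : Matrix (Fin n) (Fin n) ℝ) = exp (t • y)) (t : ℝ) :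
    ∃ g ∈ G, (g : Matrix (Fin n) (Fin n) ℝ) = exp (t • (x + y)) := by
  refine exp_mem_of_curve G (γ := fun s => exp (s • x) * exp (s • y)) (fun s => ?_) (by simp) ?_ t
  · obtain ⟨g, hg, hgx⟩ := hx s
    obtain ⟨k, hk, hky⟩ := hy s
    exact ⟨g * k, mul_mem hg hk, by simp [hgx, hky]⟩
  · have h := (hasDerivAt_exp_smul_zero x).mul (hasDerivAt_exp_smul_zero y)
    rw [zero_smul, zero_smul, exp_zero, one_mul, mul_one] at h
    exact h

theorem exp_conj_mem (G : ClosedSubgroup (GL (Fin n) ℝ)) {x : Matrix (Fin n) (Fin n) ℝ}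
    (hx : ∀ t : ℝ, ∃ g ∈ G, (g : Matrix (Fin n) (Fin n) ℝ) = exp (t • x))
    {X : GL (Fin n) ℝ} (hX : X ∈ G) (t : ℝ) :
    ∃ g ∈ G, (g : Matrix (Fin n) (Fin n) ℝ) =
      exp (t • ((X : Matrix (Fin n) (Fin n) ℝ) * x *
        ((X⁻¹ : GL (Fin n) ℝ) : Matrix (Fin n) (Fin n) ℝ))) := by
  obtain ⟨g, hg, hgx⟩ := hx t
  refine ⟨X * g * X⁻¹, mul_mem (mul_mem hX hg) (inv_mem hX), ?_⟩
  have := Matrix.exp_units_conj X (t • x)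
  rw [Units.val_mul, Units.val_mul, hgx, ← this]
  simp

/-- The Lie algebra `𝔤 = {x | exp (t x) ∈ G for all t ∈ ℝ}` of a matrix Lie group, i.e. of a closed
subgroup `G` of `GL(n, ℝ)`. -/
def lieAlgebra (G : ClosedSubgroup (GL (Fin n) ℝ)) :
    Submodule ℝ (Matrix (Fin n) (Fin n) ℝ) where
  carrier := {x | ∀ t : ℝ, ∃ g ∈ G, (g : Matrix (Fin n) (Fin n) ℝ) = exp (t • x)}
  add_mem' hx hy := exp_add_mem G hx hy
  zero_mem' _ := ⟨1, one_mem G, by simp⟩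
  smul_mem' c x hx t := by simpa [smul_smul] using hx (t * c)

theorem lie_mem (G : ClosedSubgroup (GL (Fin n) ℝ)) {x y : Matrix (Fin n) (Fin n) ℝ}
    (hx : x ∈ lieAlgebra G) (hy : y ∈ lieAlgebra G) : x * y - y * x ∈ lieAlgebra G := by
  have hd : HasDerivAt (fun s : ℝ => exp (s • x) * y * exp (s • (-x))) (x * y - y * x) 0 := by
    have := ((hasDerivAt_exp_smul_zero x).mul_const y).mul (hasDerivAt_exp_smul_zero (-x))
    rw [zero_smul, zero_smul, exp_zero, one_mul, mul_one, mul_neg, ← sub_eq_add_neg] at this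
    exact this
  have hm : ∀ s : ℝ, exp (s • x) * y * exp (s • (-x)) ∈ lieAlgebra G := by
    intro s
    obtain ⟨g, hg, hgx⟩ := hx s
    have : exp (s • (-x)) = ((g⁻¹ : GL (Fin n) ℝ) : Matrix (Fin n) (Fin n) ℝ) := by
      rw [smul_neg, Matrix.exp_neg, ← hgx, Matrix.coe_units_inv]
    rw [this, ← hgx]
    exact exp_conj_mem G hy hg
  have hcl : IsClosed (lieAlgebra G : Set (Matrix (Fin n) (Fin n) ℝ)) :=
    Submodule.closed_of_finiteDimensional _
  refine hcl.mem_of_tendsto (hasDerivAt_iff_tendsto_slope.1 hd) (Eventually.of_forall fun s => ?_)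
  exact (lieAlgebra G).smul_mem _ ((lieAlgebra G).sub_mem (hm s) (hm 0))

end Helpers

variable {G : ClosedSubgroup (GL (Fin n) ℝ)}

/-- The matrix underlying an element of the group. -/
abbrev mat (X : G) : Matrix (Fin n) (Fin n) ℝ := ((X : GL (Fin n) ℝ) : Matrix (Fin n) (Fin n) ℝ)

theorem exp_unit_mem (x : lieAlgebra G) :
    (Matrix.isUnit_exp (x : Matrix (Fin n) (Fin n) ℝ)).unit ∈ G := by
  obtain ⟨g, hg, h⟩ := x.2 1
  have : (Matrix.isUnit_exp (x : Matrix (Fin n) (Fin n) ℝ)).unit = g := by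
    apply Units.ext
    rw [IsUnit.unit_spec, h, one_smul]
  rwa [this]

/-- The matrix exponential as a map from the Lie algebra to the group. -/
def expG (x : lieAlgebra G) : G :=
  ⟨(Matrix.isUnit_exp (x : Matrix (Fin n) (Fin n) ℝ)).unit, exp_unit_mem x⟩

/-- The Lie exponential `exp_m : ℝᵈ → G`, for an identification `hat` of `ℝᵈ` with `𝔤`. -/
def expm (hat : (Fin d → ℝ) ≃ₗ[ℝ] lieAlgebra G) (x : Fin d → ℝ) : G := expG (hat x)

/-- `log` is a Lie logarithm on `D`: `D` is a neighbourhood of the identity of `G`, and on `D` the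
map `log` is a continuous inverse of `exp_m`, with `log (exp_m x) = x` for all `x` near `0`. -/
structure IsLieLog (hat : (Fin d → ℝ) ≃ₗ[ℝ] lieAlgebra G) (D : Set G) (log : G → Fin d → ℝ) :
    Prop where
  mem_nhds : D ∈ 𝓝 (1 : G)
  continuousOn : ContinuousOn log D
  exp_log : ∀ X ∈ D, expm hat (log X) = X
  log_exp : ∀ᶠ x in 𝓝 (0 : Fin d → ℝ), log (expm hat x) = x

/-- The adjoint action `Ad_X y = X y X⁻¹` of `G` on `𝔤`. -/
def Ad (X : G) (y : lieAlgebra G) : lieAlgebra G :=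
  ⟨mat X * (y : Matrix (Fin n) (Fin n) ℝ) * mat X⁻¹, exp_conj_mem G y.2 X.2⟩

/-- The adjoint action of `G` on `ℝᵈ`, i.e. `w ↦ (Ad_X w^∧)^∨`. -/
def Adm (hat : (Fin d → ℝ) ≃ₗ[ℝ] lieAlgebra G) (X : G) (w : Fin d → ℝ) : Fin d → ℝ :=
  hat.symm (Ad X (hat w))

/-- `ad_x y = [x, y] = x y - y x` on `𝔤`. -/
def ad (x : lieAlgebra G) : lieAlgebra G →ₗ[ℝ] lieAlgebra G where
  toFun y := ⟨(x : Matrix (Fin n) (Fin n) ℝ) * y - y * x, lie_mem G x.2 y.2⟩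
  map_add' y z := by ext1; simp only [Submodule.coe_add]; noncomm_ring
  map_smul' c y := by ext1; simp [smul_sub]

/-- The matrix of `ad_{x^∧} = [x^∧, ·]` under the identification `hat`. -/
def adm (hat : (Fin d → ℝ) ≃ₗ[ℝ] lieAlgebra G) (x : Fin d → ℝ) : Matrix (Fin d) (Fin d) ℝ :=
  LinearMap.toMatrix' (hat.symm.toLinearMap ∘ₗ ad (hat x) ∘ₗ hat.toLinearMap)

/-- `dexp_m(x) = ∑ adm_x ^ i / (i + 1)!`. -/
def dexpm (hat : (Fin d → ℝ) ≃ₗ[ℝ] lieAlgebra G) (x : Fin d → ℝ) : Matrix (Fin d) (Fin d) ℝ :=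
  ∑' i : ℕ, ((i + 1).factorial : ℝ)⁻¹ • adm hat x ^ i

open Classical in
/-- The inverse `M ↦ M^∨` of `hat`, extended by `0` to matrices outside `𝔤`. -/
def vee (hat : (Fin d → ℝ) ≃ₗ[ℝ] lieAlgebra G) (M : Matrix (Fin n) (Fin n) ℝ) : Fin d → ℝ :=
  if h : M ∈ lieAlgebra G then hat.symm ⟨M, h⟩ else 0

/-- `F` is a vector field on `G`: `F X` lies in the tangent space `T_X G = X 𝔤`. -/
def IsVectorField (F : G → Matrix (Fin n) (Fin n) ℝ) : Prop :=
  ∀ X : G, mat X⁻¹ * F X ∈ lieAlgebra G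

/-- `F (X Y) = F X Y + X F Y - X F(I) Y`. -/
def IsGroupAffine (F : G → Matrix (Fin n) (Fin n) ℝ) : Prop :=
  ∀ X Y : G, F (X * Y) = F X * mat Y + mat X * F Y - mat X * F 1 * mat Y

/-- A vector field in exponential coordinates: `x ↦ (exp_m(x)⁻¹ F(exp_m(x)))^∨`. -/
def pullback (hat : (Fin d → ℝ) ≃ₗ[ℝ] lieAlgebra G) (F : G → Matrix (Fin n) (Fin n) ℝ)
    (x : Fin d → ℝ) : Fin d → ℝ :=
  vee hat (mat (expm hat x)⁻¹ * F (expm hat x))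

/-- The differential at `x = 0` of `x ↦ (exp_m(x)⁻¹ F(exp_m(x)))^∨`. -/
def linearization (hat : (Fin d → ℝ) ≃ₗ[ℝ] lieAlgebra G) (F : G → Matrix (Fin n) (Fin n) ℝ) :
    (Fin d → ℝ) →L[ℝ] (Fin d → ℝ) :=
  fderiv ℝ (pullback hat F) 0

/-- The vector field of the disturbance-free left invariant error: `η ↦ F η - F(I) η`. -/
def leftErrorField (F : G → Matrix (Fin n) (Fin n) ℝ) (X : G) : Matrix (Fin n) (Fin n) ℝ :=
  F X - F 1 * mat X

/-- The vector field of the disturbance-free right invariant error: `η ↦ F η - η F(I)`. -/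
def rightErrorField (F : G → Matrix (Fin n) (Fin n) ℝ) (X : G) : Matrix (Fin n) (Fin n) ℝ :=
  F X - mat X * F 1

/-- The left invariant error `X̂⁻¹ X`. -/
def leftError (X Xhat : ℝ → G) (t : ℝ) : G := (Xhat t)⁻¹ * X t

/-- The right invariant error `X X̂⁻¹`. -/
def rightError (X Xhat : ℝ → G) (t : ℝ) : G := X t * (Xhat t)⁻¹

/-- The interval `[t₀, T)` with `T ∈ (t₀, ∞]`. -/
def timeInterval (t₀ : ℝ) (T : EReal) : Set ℝ := {t | t₀ ≤ t ∧ (t : EReal) < T}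

end MatrixLie

end

/-! Both error fields `g` satisfy `g (X Y) = g X Y + X g Y`. Hence `h s = exp(-s x) g(exp(s x))` is
a crossed homomorphism of the real line, determined by `h' 0 = A x`: `h 1` is the average over `s ∈
[0, 1]` of the conjugates `exp(-s x) (A x) exp(s x)`. The derivative of `exp` at `x` in direction
`v` is `exp x` times the same average with `v` for `A x`. So `g (exp x)` is exactly the derivative
of `exp` at `x` in direction `A x`: the nonlinear error field is linear in exponential coordinates.

In these coordinates the average is `dexp(-x)` (`hatL_dexpm_neg_mulVec`), so a disturbance `η a`
contributes `dexp(-ξ)⁻¹ a`. Differentiability of `ξ` follows from its continuity and the inverse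
function theorem (`hasDerivWithinAt_lift`). -/

namespace MatrixLie

/-! ### Conjugate averages and the derivative of the exponential -/

section BanachAlgebra

open NormedSpace Filter MeasureTheory

variable {A B : Type*} [NormedRing A] [NormedAlgebra ℝ A] [CompleteSpace A]
  [NormedRing B] [NormedAlgebra ℝ B] [CompleteSpace B]

@[fun_prop]
theorem continuous_exp_real : Continuous (exp : A → A) :=
  continuous_iff_continuousAt.2 fun x => (exp_analytic (𝕂 := ℝ) x).continuousAt

theorem exp_neg_mul_exp_real (x : A) : exp (-x) * exp x = 1 := by
  let _ := NormedAlgebra.restrictScalars ℚ ℝ A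
  rw [← exp_add_of_commute (Commute.neg_left (Commute.refl x)), neg_add_cancel, exp_zero]

theorem exp_mul_exp_neg_real (x : A) : exp x * exp (-x) = 1 := by
  simpa using exp_neg_mul_exp_real (-x)

/-- The average `∫₀¹ exp(-s x) v exp(s x) ds` of the conjugates of `v` along `exp(s x)`. -/
noncomputable def conjAverage (x v : A) : A :=
  ∫ s in (0 : ℝ)..1, exp (s • (-x)) * v * exp (s • x)

/-- Duhamel's formula. -/
theorem exp_neg_mul_exp_add (x v : A) :
    exp (-x) * exp (x + v) = 1 + ∫ s in (0 : ℝ)..1, exp (s • (-x)) * v * exp (s • (x + v)) := by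
  -- The product rule gives the middle factor `-x + (x + v) = v`.
  have hd : ∀ s : ℝ, HasDerivAt (fun s : ℝ => exp (s • (-x)) * exp (s • (x + v)))
      (exp (s • (-x)) * v * exp (s • (x + v))) s := fun s => by
    refine ((hasDerivAt_exp_smul_const (𝕂 := ℝ) (-x) s).mul
      (hasDerivAt_exp_smul_const' (𝕂 := ℝ) (x + v) s)).congr_deriv ?_
    noncomm_ring
  rw [intervalIntegral.integral_eq_sub_of_hasDerivAt (fun s _ => hd s)
    (Continuous.intervalIntegrable (by fun_prop) _ _)]
  simp

/-- Duhamel's formula with `ε v` for `v` writes the difference quotient as an integral continuous in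
`ε`, so the limit is its value at `ε = 0`. -/
theorem hasDerivAt_exp_add_smul (x v : A) :
    HasDerivAt (fun ε : ℝ => exp (x + ε • v)) (exp x * conjAverage x v) 0 := by
  have hI : Continuous fun ε : ℝ =>
      exp x * ∫ s in (0 : ℝ)..1, exp (s • (-x)) * v * exp (s • (x + ε • v)) := by
    refine continuous_const.mul
      (intervalIntegral.continuous_parametric_intervalIntegral_of_continuous' ?_ _ _)
    fun_prop
  rw [hasDerivAt_iff_tendsto_slope]
  have h0 := (hI.tendsto 0).mono_left (nhdsWithin_le_nhds (s := {0}ᶜ))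
  simp only [zero_smul, add_zero] at h0
  refine h0.congr' ?_
  filter_upwards [self_mem_nhdsWithin] with ε hε
  have hε : ε ≠ 0 := hε
  have h1 : exp (x + ε • v) = exp x +
      ε • (exp x * ∫ s in (0 : ℝ)..1, exp (s • (-x)) * v * exp (s • (x + ε • v))) := by
    rw [← one_mul (exp (x + ε • v)), ← exp_mul_exp_neg_real x, mul_assoc, exp_neg_mul_exp_add,
      mul_add, mul_one, ← mul_smul_comm, ← intervalIntegral.integral_smul]
    simp
  rw [slope_def_module, h1]
  simp [smul_smul, hε]

theorem hasStrictFDerivAt_exp_real (x : A) :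
    HasStrictFDerivAt (exp : A → A) (fderiv ℝ exp x) x :=
  (exp_analytic (𝕂 := ℝ) x).hasStrictFDerivAt

theorem fderiv_exp_apply (x v : A) : fderiv ℝ exp x v = exp x * conjAverage x v := by
  have h1 : HasDerivAt (fun ε : ℝ => x + ε • v) v 0 := by
    simpa using ((hasDerivAt_id (0 : ℝ)).smul_const v).const_add x
  have h2 : HasFDerivAt (exp : A → A) (fderiv ℝ exp x) (x + (0 : ℝ) • v) := by
    simpa using (hasStrictFDerivAt_exp_real x).hasFDerivAt
  exact (h2.comp_hasDerivAt (0 : ℝ) h1).unique (hasDerivAt_exp_add_smul x v)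

/-- Termwise integration: `∫₀¹ sⁱ ds = 1 / (i + 1)` turns `1 / i!` into `1 / (i + 1)!`. -/
theorem integral_exp_smul (b : B) :
    ∫ s in (0 : ℝ)..1, exp (s • b) = ∑' i : ℕ, ((i + 1).factorial : ℝ)⁻¹ • b ^ i := by
  have hs := intervalIntegral.hasSum_integral_of_dominated_convergence (a := 0) (b := 1)
    (μ := volume) (F := fun (i : ℕ) (s : ℝ) => (i.factorial : ℝ)⁻¹ • (s • b) ^ i)
    (f := fun s => exp (s • b)) (fun i _ => ‖(i.factorial : ℝ)⁻¹ • b ^ i‖)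
    (fun i => Continuous.aestronglyMeasurable (by fun_prop))
    (fun i => Eventually.of_forall fun s hs => ?_)
    (Eventually.of_forall fun s _ => norm_expSeries_summable' (𝕂 := ℝ) b)
    (by simp)
    (Eventually.of_forall fun s _ => exp_series_hasSum_exp' (𝕂 := ℝ) (s • b))
  · rw [← hs.tsum_eq]
    refine tsum_congr fun i => ?_
    simp_rw [smul_pow, smul_smul]
    rw [intervalIntegral.integral_smul_const, intervalIntegral.integral_const_mul, integral_pow,
      Nat.factorial_succ]
    congr 1
    push_cast
    simp
  · rw [Set.uIoc_of_le zero_le_one] at hs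
    rw [smul_pow, smul_comm, norm_smul]
    refine mul_le_of_le_one_left (norm_nonneg _) ?_
    rw [norm_pow, Real.norm_of_nonneg hs.1.le]
    exact pow_le_one₀ hs.1.le hs.2

/-- If left multiplication by `b` corresponds under `H` to `-[x, ·]`, then `exp (s b)` corresponds
to conjugation by `exp (-s x)`. -/
theorem map_exp_smul_of_intertwines (H : B →L[ℝ] A) {b : B} {x : A}
    (h : ∀ p, H (b * p) = H p * x - x * H p) (s : ℝ) :
    H (exp (s • b)) = exp (s • (-x)) * H 1 * exp (s • x) := by
  -- Undoing the expected conjugation gives a curve with zero derivative, hence constantly `H 1`.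
  have hd : ∀ s : ℝ, HasDerivAt (fun s : ℝ => exp (s • x) * H (exp (s • b)) * exp (s • (-x))) 0 s :=
    fun s => by
    refine (((hasDerivAt_exp_smul_const (𝕂 := ℝ) x s).mul
      (H.hasFDerivAt.comp_hasDerivAt s (hasDerivAt_exp_smul_const' (𝕂 := ℝ) b s))).mul
      (hasDerivAt_exp_smul_const' (𝕂 := ℝ) (-x) s)).congr_deriv ?_
    simp only [Pi.mul_apply, Function.comp_apply, h]
    noncomm_ring
  have hc := is_const_of_deriv_eq_zero (fun s => (hd s).differentiableAt) (fun s => (hd s).deriv)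
    s 0
  simp only [zero_smul, exp_zero, one_mul, mul_one] at hc
  rw [← hc, smul_neg]
  simp only [mul_assoc]
  rw [exp_neg_mul_exp_real, mul_one, ← mul_assoc, exp_neg_mul_exp_real, one_mul]

theorem map_tsum_of_intertwines (H : B →L[ℝ] A) {b : B} {x : A}
    (h : ∀ p, H (b * p) = H p * x - x * H p) :
    H (∑' i : ℕ, ((i + 1).factorial : ℝ)⁻¹ • b ^ i) = conjAverage x (H 1) := by
  rw [← integral_exp_smul, conjAverage, ← ContinuousLinearMap.intervalIntegral_comp_comm]
  · simp_rw [map_exp_smul_of_intertwines H h]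
  · exact Continuous.intervalIntegrable (by fun_prop) _ _

/-- A crossed homomorphism along a one-parameter subgroup is the integral of the conjugates of its
velocity at `0`. -/
theorem eq_conjAverage_of_cocycle {h : ℝ → A} {x z : A} (h0 : HasDerivAt h z 0)
    (hh : ∀ r s, h (r + s) = exp (s • (-x)) * h r * exp (s • x) + h s) :
    h 1 = conjAverage x z := by
  have hz : h 0 = 0 := by simpa using hh 0 0
  -- Writing `r = (r - s) + s` in the cocycle identity carries the derivative at `0` to `s`.
  have hd : ∀ s, HasDerivAt h (exp (s • (-x)) * z * exp (s • x)) s := fun s => by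
    have h1 : HasDerivAt (fun r => h (r - s)) z s := by
      refine HasDerivAt.comp_sub_const s s ?_
      simpa using h0
    have h2 := ((h1.const_mul (exp (s • (-x)))).mul_const (exp (s • x))).add_const (h s)
    refine h2.congr_of_eventuallyEq (Eventually.of_forall fun r => ?_)
    simpa using hh (r - s) s
  have := intervalIntegral.integral_eq_sub_of_hasDerivAt (a := 0) (b := 1) (fun s _ => hd s)
    (Continuous.intervalIntegrable (by fun_prop) _ _)
  rw [conjAverage, this, hz, sub_zero]

end BanachAlgebra

/-- A continuous lift `ξ` of a differentiable curve through a map with injective strict derivative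
is differentiable. -/
theorem hasDerivWithinAt_lift {E F : Type*} [NormedAddCommGroup E] [NormedSpace ℝ E]
    [FiniteDimensional ℝ E] [NormedAddCommGroup F] [NormedSpace ℝ F] [FiniteDimensional ℝ F]
    {φ : E → F} {L : E →L[ℝ] F} {ξ : ℝ → E} {S : Set ℝ} {t : ℝ} {v : E}
    (hφ : HasStrictFDerivAt φ L (ξ t)) (hL : Function.Injective L)
    (hξ : ContinuousWithinAt ξ S t) (hd : HasDerivWithinAt (fun s => φ (ξ s)) (L v) S t) :
    HasDerivWithinAt ξ v S t := by
  obtain ⟨P, hP⟩ := L.toLinearMap.exists_leftInverse_of_injective (LinearMap.ker_eq_bot.2 hL)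
  let Pc : F →L[ℝ] E := LinearMap.toContinuousLinearMap P
  have hPL : ∀ e, Pc (L e) = e := fun e => LinearMap.congr_fun hP e
  -- Composing with a left inverse of `L` makes the derivative the identity, so the inverse function
  -- theorem applies even if `L` is not surjective.
  have h1 : HasStrictFDerivAt (Pc ∘ φ) ((ContinuousLinearEquiv.refl ℝ E : E ≃L[ℝ] E) : E →L[ℝ] E)
      (ξ t) := by
    have hc : Pc.comp L = ((ContinuousLinearEquiv.refl ℝ E : E ≃L[ℝ] E) : E →L[ℝ] E) :=
      ContinuousLinearMap.ext hPL
    rw [← hc]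
    exact Pc.hasStrictFDerivAt.comp (ξ t) hφ
  have h2 : HasDerivWithinAt (fun s => Pc (φ (ξ s))) v S t := by
    have := Pc.hasFDerivAt.comp_hasDerivWithinAt t hd
    rwa [hPL] at this
  have h3 := h1.to_localInverse.hasFDerivAt.comp_hasDerivWithinAt t h2
  refine HasDerivWithinAt.congr_of_eventuallyEq h3 ?_ ?_
  -- Continuity keeps `ξ s` in the region where the local inverse recovers it.
  · filter_upwards [hξ.eventually h1.eventually_left_inverse] with s hs
    exact hs.symm
  · exact h1.localInverse_apply_image.symm

/-! ### Exponential coordinates on the group -/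

section Coordinates

open NormedSpace Filter

open scoped Matrix.Norms.Operator

variable {n d : ℕ} {G : ClosedSubgroup (GL (Fin n) ℝ)}

theorem mat_mul (X Y : G) : mat (X * Y) = mat X * mat Y := rfl

theorem mat_one : mat (1 : G) = 1 := rfl

theorem mat_mul_inv (X : G) : mat X * mat X⁻¹ = 1 := by
  rw [← mat_mul, mul_inv_cancel, mat_one]

theorem mat_inv_mul (X : G) : mat X⁻¹ * mat X = 1 := by
  rw [← mat_mul, inv_mul_cancel, mat_one]

theorem mat_injective : Function.Injective (mat : G → Matrix (Fin n) (Fin n) ℝ) :=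
  fun _ _ h => Subtype.ext (Units.ext h)

theorem isInducing_mat : Topology.IsInducing (mat : G → Matrix (Fin n) (Fin n) ℝ) :=
  (Units.isOpenEmbedding_val (R := Matrix (Fin n) (Fin n) ℝ)).isInducing.comp
    Topology.IsInducing.subtypeVal

theorem mat_inv_eq (X : G) : mat X⁻¹ = Ring.inverse (mat X) :=
  (Ring.inverse_unit (X : GL (Fin n) ℝ)).symm

theorem hasDerivWithinAt_mat_inv {X : ℝ → G} {dX : Matrix (Fin n) (Fin n) ℝ} {S : Set ℝ} {t : ℝ}
    (h : HasDerivWithinAt (fun s => mat (X s)) dX S t) :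
    HasDerivWithinAt (fun s => mat (X s)⁻¹) (-(mat (X t)⁻¹ * dX * mat (X t)⁻¹)) S t := by
  have h1 := (hasFDerivAt_ringInverse (𝕜 := ℝ) (X t : GL (Fin n) ℝ)).comp_hasDerivWithinAt t h
  simp_rw [mat_inv_eq]
  refine h1.congr_deriv ?_
  rw [← mat_inv_eq]
  rfl

/-- `hat` as a continuous linear map into the matrices. -/
noncomputable def hatL (hat : (Fin d → ℝ) ≃ₗ[ℝ] lieAlgebra G) :
    (Fin d → ℝ) →L[ℝ] Matrix (Fin n) (Fin n) ℝ :=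
  LinearMap.toContinuousLinearMap ((lieAlgebra G).subtype ∘ₗ hat.toLinearMap)

variable (hat : (Fin d → ℝ) ≃ₗ[ℝ] lieAlgebra G)

theorem hatL_apply (x : Fin d → ℝ) : hatL hat x = (hat x : Matrix (Fin n) (Fin n) ℝ) := rfl

theorem hatL_injective : Function.Injective (hatL hat) :=
  Subtype.val_injective.comp hat.injective

theorem hatL_vee {M : Matrix (Fin n) (Fin n) ℝ} (h : M ∈ lieAlgebra G) :
    hatL hat (vee hat M) = M := by
  simp [vee, h, hatL_apply]

theorem matrix_exp_neg_mul_exp (M : Matrix (Fin n) (Fin n) ℝ) : exp (-M) * exp M = 1 :=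
  exp_neg_mul_exp_real M

theorem mat_expm (x : Fin d → ℝ) : mat (expm hat x) = exp (hatL hat x) := rfl

theorem mat_expm_inv (x : Fin d → ℝ) : mat (expm hat x)⁻¹ = exp (-hatL hat x) := by
  have h := mat_mul_inv (expm hat x)
  rw [mat_expm] at h
  rw [← one_mul (mat _), ← matrix_exp_neg_mul_exp (hatL hat x), mul_assoc, h, mul_one]

theorem expm_add_smul (x : Fin d → ℝ) (r s : ℝ) :
    expm hat ((r + s) • x) = expm hat (r • x) * expm hat (s • x) := by
  refine mat_injective ?_
  rw [mat_mul, mat_expm, mat_expm, mat_expm, add_smul, map_add, map_smul, map_smul]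
  exact Matrix.exp_add_of_commute _ _ (((Commute.refl _).smul_left r).smul_right s)

/-- Intertwining is applied to `H p = (p v)^∧`; the sign in `-x` matches `[-x, y] = y x - x y`. -/
theorem hatL_dexpm_neg_mulVec (x v : Fin d → ℝ) :
    hatL hat (dexpm hat (-x) *ᵥ v) = conjAverage (hatL hat x) (hatL hat v) := by
  let H : Matrix (Fin d) (Fin d) ℝ →L[ℝ] Matrix (Fin n) (Fin n) ℝ :=
    LinearMap.toContinuousLinearMap
      ((hatL hat).toLinearMap ∘ₗ (LinearMap.applyₗ v) ∘ₗ (Matrix.toLin' (R := ℝ)).toLinearMap)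
  have key := map_tsum_of_intertwines H (b := adm hat (-x)) (x := hatL hat x) fun p => by
    change hatL hat ((adm hat (-x) * p) *ᵥ v) =
      hatL hat (p *ᵥ v) * hatL hat x - hatL hat x * hatL hat (p *ᵥ v)
    rw [← Matrix.mulVec_mulVec, adm, LinearMap.toMatrix'_mulVec]
    simp [hatL_apply, ad]
    abel
  have h1 : H 1 = hatL hat v := congrArg (hatL hat) (Matrix.one_mulVec v)
  exact key.trans (congrArg (conjAverage (hatL hat x)) h1)

theorem hatL_pullback {F : G → Matrix (Fin n) (Fin n) ℝ} (hF : IsVectorField F) (x : Fin d → ℝ) :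
    hatL hat (pullback hat F x) = exp (-hatL hat x) * F (expm hat x) := by
  rw [pullback, hatL_vee hat (hF _), mat_expm_inv]

/-- `hatL` has a linear left inverse, so differentiability can be tested on matrices, where product
rules apply. -/
theorem differentiableAt_pullback_iff {F : G → Matrix (Fin n) (Fin n) ℝ} (hF : IsVectorField F)
    (x : Fin d → ℝ) : DifferentiableAt ℝ (pullback hat F) x ↔
      DifferentiableAt ℝ (fun y => exp (-hatL hat y) * F (expm hat y)) x := by
  have he : (fun y => exp (-hatL hat y) * F (expm hat y)) = hatL hat ∘ pullback hat F :=
    funext fun y => (hatL_pullback hat hF y).symm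
  rw [he]
  refine ⟨fun h => (hatL hat).differentiableAt.comp x h, fun h => ?_⟩
  obtain ⟨P, hP⟩ := (hatL hat).toLinearMap.exists_leftInverse_of_injective
    (LinearMap.ker_eq_bot.2 (hatL_injective hat))
  have h1 := (LinearMap.toContinuousLinearMap P).differentiableAt.comp x h
  have h2 : (LinearMap.toContinuousLinearMap P) ∘ hatL hat ∘ pullback hat F = pullback hat F :=
    funext fun y => LinearMap.congr_fun hP (pullback hat F y)
  rwa [h2] at h1

/-- `g (X Y) = g X Y + X g Y`. -/
def IsDerivationField (g : G → Matrix (Fin n) (Fin n) ℝ) : Prop :=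
  ∀ X Y : G, g (X * Y) = g X * mat Y + mat X * g Y

/-- In exponential coordinates a derivation field is determined by its linearization:
`exp(x)⁻¹ g(exp x) = dexp(-x) A x`. -/
theorem IsDerivationField.apply_expm {g : G → Matrix (Fin n) (Fin n) ℝ}
    (hg : IsDerivationField g) (hv : IsVectorField g)
    (hd : DifferentiableAt ℝ (pullback hat g) 0) (x : Fin d → ℝ) :
    g (expm hat x) = mat (expm hat x) *
      hatL hat (dexpm hat (-x) *ᵥ linearization hat g x) := by
  have h0 : HasDerivAt (fun s : ℝ => hatL hat (pullback hat g (s • x)))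
      (hatL hat (linearization hat g x)) 0 := by
    have h1 : HasDerivAt (fun s : ℝ => s • x) x 0 := by
      simpa using (hasDerivAt_id (0 : ℝ)).smul_const x
    have h2 : HasFDerivAt (pullback hat g) (linearization hat g) ((0 : ℝ) • x) := by
      rw [zero_smul]
      exact hd.hasFDerivAt
    have h3 := HasFDerivAt.comp_hasDerivAt (l := pullback hat g) (0 : ℝ) h2 h1
    exact (hatL hat).hasFDerivAt.comp_hasDerivAt (0 : ℝ) h3
  -- The derivation rule on `exp_m(r x) exp_m(s x)` yields the cocycle identity.
  have h1 := eq_conjAverage_of_cocycle (x := hatL hat x) h0 fun r s => by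
    simp only [hatL_pullback hat hv, ← mat_expm_inv]
    rw [expm_add_smul, hg, smul_neg, ← map_smul, mul_inv_rev, mat_mul]
    change _ = exp (-hatL hat (s • x)) * _ * mat (expm hat (s • x)) + _
    rw [← mat_expm_inv]
    simp only [mul_add, mul_assoc]
    rw [← mul_assoc (mat (expm hat (r • x))⁻¹) (mat (expm hat (r • x))), mat_inv_mul, one_mul]
  rw [hatL_dexpm_neg_mulVec, ← h1, one_smul, hatL_pullback hat hv, ← mat_expm_inv, ← mul_assoc,
    mat_mul_inv, one_mul]

theorem hasDerivWithinAt_log {g : G → Matrix (Fin n) (Fin n) ℝ}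
    (hg : IsDerivationField g) (hv : IsVectorField g)
    (hd : DifferentiableAt ℝ (pullback hat g) 0) {D : Set G} {log : G → Fin d → ℝ}
    (hlog : IsLieLog hat D log) {S : Set ℝ} {η : ℝ → G} (hηD : ∀ s ∈ S, η s ∈ D)
    {ξ : ℝ → Fin d → ℝ} (hξ : ∀ s ∈ S, ξ s = log (η s)) {t : ℝ} (ht : t ∈ S)
    (hu : IsUnit (dexpm hat (-ξ t))) {a : Fin d → ℝ}
    (hη : HasDerivWithinAt (fun s => mat (η s)) (g (η t) + mat (η t) * hatL hat a) S t) :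
    HasDerivWithinAt ξ ((dexpm hat (-ξ t))⁻¹ *ᵥ a + linearization hat g (ξ t)) S t := by
  have hexp : ∀ s ∈ S, expm hat (ξ s) = η s := fun s hs => by
    rw [hξ s hs, hlog.exp_log _ (hηD s hs)]
  have hdet := (Matrix.isUnit_iff_isUnit_det _).1 hu
  have hL : ∀ v, ((fderiv ℝ exp (hatL hat (ξ t))).comp (hatL hat)) v =
      mat (η t) * hatL hat (dexpm hat (-ξ t) *ᵥ v) := fun v => by
    rw [hatL_dexpm_neg_mulVec, ← hexp t ht]
    exact fderiv_exp_apply _ _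
  refine hasDerivWithinAt_lift (φ := fun x => exp (hatL hat x))
    (L := (fderiv ℝ exp (hatL hat (ξ t))).comp (hatL hat)) ?_ ?_ ?_ ?_
  · exact (hasStrictFDerivAt_exp_real _).comp (ξ t) (hatL hat).hasStrictFDerivAt
  · intro v y hvy
    have h1 := congrArg (mat (η t)⁻¹ * ·) ((hL v).symm.trans (hvy.trans (hL y)))
    simp only [← mul_assoc, mat_inv_mul, one_mul] at h1
    exact Matrix.mulVec_injective_of_isUnit hu (hatL_injective hat h1)
  -- `G` carries the topology induced from matrices, so `η` is continuous in `G` and `log ∘ η` is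
  -- continuous.
  · have hc : ContinuousWithinAt η S t :=
      isInducing_mat.continuousWithinAt_iff.2 hη.continuousWithinAt
    refine ((hlog.continuousOn (η t) (hηD t ht)).comp hc hηD).congr hξ (hξ t ht)
  · have hη' : HasDerivWithinAt (fun s => exp (hatL hat (ξ s)))
        (g (η t) + mat (η t) * hatL hat a) S t :=
      hη.congr (fun s hs => by rw [← mat_expm, hexp s hs]) (by rw [← mat_expm, hexp t ht])
    refine hη'.congr_deriv (Eq.trans ?_ (hL _).symm)
    rw [Matrix.mulVec_add, Matrix.mulVec_mulVec, Matrix.mul_nonsing_inv _ hdet,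
      Matrix.one_mulVec, map_add, mul_add, add_comm]
    congr 1
    rw [← hexp t ht, hg.apply_expm hat hv hd]

/-! ### Error fields and error dynamics -/

variable {F : G → Matrix (Fin n) (Fin n) ℝ}

theorem IsGroupAffine.leftErrorField (hF : IsGroupAffine F) :
    IsDerivationField (leftErrorField F) := fun X Y => by
  simp only [MatrixLie.leftErrorField, hF X Y, mat_mul]
  noncomm_ring

theorem IsGroupAffine.rightErrorField (hF : IsGroupAffine F) :
    IsDerivationField (rightErrorField F) := fun X Y => by
  simp only [MatrixLie.rightErrorField, hF X Y, mat_mul]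
  noncomm_ring

theorem IsVectorField.apply_one_mem (hF : IsVectorField F) : F 1 ∈ lieAlgebra G := by
  simpa [mat_one] using hF 1

theorem IsVectorField.leftErrorField (hF : IsVectorField F) :
    IsVectorField (leftErrorField F) := fun X => by
  -- The correction term `X⁻¹ F(I) X` is a conjugate of `F(I) ∈ 𝔤`.
  have h := (Ad X⁻¹ ⟨F 1, hF.apply_one_mem⟩).2
  simp only [Ad, inv_inv] at h
  rw [MatrixLie.leftErrorField, mul_sub, ← mul_assoc]
  exact (lieAlgebra G).sub_mem (hF X) h

theorem IsVectorField.rightErrorField (hF : IsVectorField F) :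
    IsVectorField (rightErrorField F) := fun X => by
  rw [MatrixLie.rightErrorField, mul_sub, ← mul_assoc, mat_inv_mul, one_mul]
  exact (lieAlgebra G).sub_mem (hF X) hF.apply_one_mem

theorem differentiableAt_exp_real {m : ℕ} (x : Matrix (Fin m) (Fin m) ℝ) :
    DifferentiableAt ℝ (exp : Matrix (Fin m) (Fin m) ℝ → Matrix (Fin m) (Fin m) ℝ) x :=
  (hasStrictFDerivAt_exp_real x).hasFDerivAt.differentiableAt

theorem differentiableAt_pullback_leftErrorField (hF : IsVectorField F)
    (hd : DifferentiableAt ℝ (pullback hat F) 0) :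
    DifferentiableAt ℝ (pullback hat (leftErrorField F)) 0 := by
  rw [differentiableAt_pullback_iff hat hF] at hd
  rw [differentiableAt_pullback_iff hat hF.leftErrorField]
  simp only [leftErrorField, mul_sub, mat_expm]
  have h1 : DifferentiableAt ℝ (fun y => exp (hatL hat y)) 0 :=
    (differentiableAt_exp_real _).comp _ (hatL hat).differentiableAt
  have h2 : DifferentiableAt ℝ (fun y => exp (-hatL hat y)) 0 :=
    (differentiableAt_exp_real _).comp _ (hatL hat).differentiableAt.neg
  exact hd.sub (h2.mul (h1.const_mul (F 1)))

theorem differentiableAt_pullback_rightErrorField (hF : IsVectorField F)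
    (hd : DifferentiableAt ℝ (pullback hat F) 0) :
    DifferentiableAt ℝ (pullback hat (rightErrorField F)) 0 := by
  rw [differentiableAt_pullback_iff hat hF] at hd
  rw [differentiableAt_pullback_iff hat hF.rightErrorField]
  simp only [rightErrorField, mul_sub, mat_expm]
  simp only [← mul_assoc, matrix_exp_neg_mul_exp, one_mul]
  exact hd.sub_const _

/-- Expand `F` at `X = X̂ η`: the term `X̂⁻¹ F(X̂) η` cancels against the derivative of `X̂⁻¹`, so
the error field depends on `η` alone. -/
theorem hasDerivWithinAt_leftError (hF : IsGroupAffine F) {X Xhat : ℝ → G} {S : Set ℝ} {t : ℝ}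
    {W : Matrix (Fin n) (Fin n) ℝ}
    (hX : HasDerivWithinAt (fun s => mat (X s)) (F (X t) + mat (X t) * W) S t)
    (hXhat : HasDerivWithinAt (fun s => mat (Xhat s)) (F (Xhat t)) S t) :
    HasDerivWithinAt (fun s => mat (leftError X Xhat s))
      (leftErrorField F (leftError X Xhat t) + mat (leftError X Xhat t) * W) S t := by
  refine ((hasDerivWithinAt_mat_inv hXhat).mul hX).congr_deriv ?_
  have h1 : F (X t) = F (Xhat t * leftError X Xhat t) := by simp [leftError]
  rw [h1, hF, leftErrorField]
  simp only [mul_add, mul_sub, ← mul_assoc, mat_inv_mul, one_mul, neg_mul]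
  simp only [leftError, mat_mul, ← mul_assoc]
  abel

/-- Now `X = η X̂`, and `η F(X̂) X̂⁻¹` cancels. The disturbance is conjugated since `X W X̂⁻¹ = η
(X̂ W X̂⁻¹)`. -/
theorem hasDerivWithinAt_rightError (hF : IsGroupAffine F) {X Xhat : ℝ → G} {S : Set ℝ} {t : ℝ}
    {W : Matrix (Fin n) (Fin n) ℝ}
    (hX : HasDerivWithinAt (fun s => mat (X s)) (F (X t) + mat (X t) * W) S t)
    (hXhat : HasDerivWithinAt (fun s => mat (Xhat s)) (F (Xhat t)) S t) :
    HasDerivWithinAt (fun s => mat (rightError X Xhat s))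
      (rightErrorField F (rightError X Xhat t) +
        mat (rightError X Xhat t) * (mat (Xhat t) * W * mat (Xhat t)⁻¹)) S t := by
  refine (hX.mul (hasDerivWithinAt_mat_inv hXhat)).congr_deriv ?_
  have h1 : F (X t) = F (rightError X Xhat t * Xhat t) := by simp [rightError]
  have h2 : mat (X t) = mat (rightError X Xhat t) * mat (Xhat t) := by
    rw [← mat_mul]; simp [rightError]
  rw [h1, hF, rightErrorField, h2]
  simp only [add_mul, sub_mul, mul_assoc, mat_mul_inv, mul_one, mul_neg]
  rw [← mul_assoc (mat (Xhat t)) (mat (Xhat t)⁻¹), mat_mul_inv, one_mul]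
  abel

end Coordinates

end MatrixLie

open MatrixLie in
theorem theorem2 {n d : ℕ} {G : ClosedSubgroup (GL (Fin n) ℝ)}
    (hat : (Fin d → ℝ) ≃ₗ[ℝ] lieAlgebra G)
    {U : Type*} (f : U → G → Matrix (Fin n) (Fin n) ℝ)
    (hf_tangent : ∀ a, IsVectorField (f a))
    (hf_affine : ∀ a, IsGroupAffine (f a))
    (hf_diff : ∀ a, DifferentiableAt ℝ (pullback hat (f a)) 0)
    (t₀ : ℝ) (T : EReal) (hT : (t₀ : EReal) < T)
    (u : ℝ → U) (w : ℝ → Fin d → ℝ)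
    (hw : ContDiffOn ℝ ∞ w (timeInterval t₀ T))
    (X Xhat : ℝ → G)
    (hX : ∀ t ∈ timeInterval t₀ T, HasDerivWithinAt (fun s => mat (X s))
      (f (u t) (X t) + mat (X t) * (hat (w t) : Matrix (Fin n) (Fin n) ℝ)) (timeInterval t₀ T) t)
    (hXhat : ∀ t ∈ timeInterval t₀ T, HasDerivWithinAt (fun s => mat (Xhat s))
      (f (u t) (Xhat t)) (timeInterval t₀ T) t)
    (D : Set G) (log : G → Fin d → ℝ) (hlog : IsLieLog hat D log) :
    ((∀ t ∈ timeInterval t₀ T, leftError X Xhat t ∈ D) →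
      ∀ ξ : ℝ → Fin d → ℝ, (∀ t ∈ timeInterval t₀ T, ξ t = log (leftError X Xhat t)) →
      (∀ t ∈ timeInterval t₀ T, IsUnit (dexpm hat (-ξ t))) →
      ∀ t ∈ timeInterval t₀ T, HasDerivWithinAt ξ
        ((dexpm hat (-ξ t))⁻¹ *ᵥ w t + linearization hat (leftErrorField (f (u t))) (ξ t))
        (timeInterval t₀ T) t) ∧
    ((∀ t ∈ timeInterval t₀ T, rightError X Xhat t ∈ D) →
      ∀ ξ : ℝ → Fin d → ℝ, (∀ t ∈ timeInterval t₀ T, ξ t = log (rightError X Xhat t)) →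
      (∀ t ∈ timeInterval t₀ T, IsUnit (dexpm hat (-ξ t))) →
      ∀ t ∈ timeInterval t₀ T, HasDerivWithinAt ξ
        ((dexpm hat (-ξ t))⁻¹ *ᵥ Adm hat (Xhat t) (w t) +
          linearization hat (rightErrorField (f (u t))) (ξ t))
        (timeInterval t₀ T) t) := by
  refine ⟨fun hD ξ hξ hu t ht => ?_, fun hD ξ hξ hu t ht => ?_⟩
  · exact hasDerivWithinAt_log hat (hf_affine (u t)).leftErrorField (hf_tangent (u t)).leftErrorField
      (differentiableAt_pullback_leftErrorField hat (hf_tangent (u t)) (hf_diff (u t))) hlog hD hξ ht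
      (hu t ht) (hasDerivWithinAt_leftError (hf_affine (u t)) (hX t ht) (hXhat t ht))
  · refine hasDerivWithinAt_log hat (hf_affine (u t)).rightErrorField
      (hf_tangent (u t)).rightErrorField
      (differentiableAt_pullback_rightErrorField hat (hf_tangent (u t)) (hf_diff (u t))) hlog hD hξ ht
      (hu t ht) ?_
    have h := hasDerivWithinAt_rightError (hf_affine (u t)) (hX t ht) (hXhat t ht)
    rwa [hatL_apply, Adm, hat.apply_symm_apply]
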